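/- Let $k$ be a field, let $V$ be a finite-dimensional $k$-vector space and let $r\ge 0$ be an integer. The group $GL(V)$ acts diagonally on the tensor power $V^{\otimes r}$ (over $k$), $g(x_1\otimes\cdots\otimes x_r)=gx_1\otimes\cdots\otimes gx_r$, and the symmetric group $\mathfrak{S}_r$ acts by place permutation, $\sigma(x_1\otimes\cdots\otimes x_r)=x_{\sigma^{-1}(1)}\otimes\cdots\otimes x_{\sigma^{-1}(r)}$. These two actions commute. Suppose that $k$ has strictly more than $r$ elements (for instance, $k$ may be infinite). Then the natural $k$-algebra homomorphisms $$\varphi\colon k\,GL(V)\to \mathrm{End}_{\mathfrak{S}_r}(V^{\otimes r}),\qquad \rho\colon k\mathfrak{S}_r\to \mathrm{End}_{GL(V)}(V^{\otimes r})$$ from the group algebras to the algebras of endomorphisms commuting with the other action are both surjective. The same statement holds with $GL(V)$ replaced by $SL(V)$: the natural maps $k\,SL(V)\to \mathrm{End}_{\mathfrak{S}_r}(V^{\otimes r})$ and $k\mathfrak{S}_r\to \mathrm{End}_{SL(V)}(V^{\otimes r})$ are both surjective. -/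

import Mathlib

open scoped TensorProduct

noncomputable section

namespace SchurWeyl

universe u v w x

section General

variable {k : Type u} [Field k] {G : Type v} [Group G] {H : Type w} [Group H]
  {W : Type x} [AddCommGroup W] [Module k W]

/-- For commuting linear actions `ρ` of `G` and `σ` of `H` on `W`, the natural `k`-algebra
homomorphism `kG → End_H(W)`, sending `g : G` to the operator `ρ g`. -/
def toCommutant (ρ : Representation k G W) (σ : Representation k H W)
    (hc : ∀ g h, ρ g ∘ₗ σ h = σ h ∘ₗ ρ g) :
    MonoidAlgebra k G →ₐ[k] σ.IntertwiningMap σ :=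
  MonoidAlgebra.lift k (σ.IntertwiningMap σ) G
    { toFun := fun g => { toLinearMap := ρ g, isIntertwining' := hc g }
      map_one' := by ext x; simp
      map_mul' := fun g₁ g₂ => by ext x; simp }

/-- The operator on `W` underlying `toCommutant ρ σ hc a` is the usual action of `a : kG`. -/
theorem toCommutant_toLinearMap (ρ : Representation k G W) (σ : Representation k H W)
    (hc : ∀ g h, ρ g ∘ₗ σ h = σ h ∘ₗ ρ g) (a : MonoidAlgebra k G) :
    (toCommutant ρ σ hc a).toLinearMap = ρ.asAlgebraHom a := by
  induction a using MonoidAlgebra.induction_on with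
  | of g => ext x; simp [toCommutant]
  | add a b ha hb => simp [ha, hb]
  | smul c a ha => simp [ha]

end General

variable (k : Type u) [Field k] (V : Type v) [AddCommGroup V] [Module k V] (r : ℕ)

/-- The natural representation of `GL(V)` on `V`. -/
def glNat : Representation k (LinearMap.GeneralLinearGroup k V) V :=
  Units.coeHom (Module.End k V)

/-- The natural representation of `SL(V)` on `V`. -/
def slNat : Representation k (SpecialLinearGroup k V) V where
  toFun u := (u.1 : V →ₗ[k] V)
  map_one' := rfl
  map_mul' _ _ := rfl

variable {k V}

/-- The diagonal action on `V^{⊗r}`: `g (x₁ ⊗ ⋯ ⊗ xᵣ) = g x₁ ⊗ ⋯ ⊗ g xᵣ`. -/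
def tensorRep {G : Type w} [Group G] (π : Representation k G V) :
    Representation k G (⨂[k]^r V) where
  toFun g := PiTensorProduct.map (fun _ : Fin r => π g)
  map_one' := by simp
  map_mul' g h := by
    rw [map_mul]
    exact PiTensorProduct.map_mul (fun _ : Fin r => π g) (fun _ : Fin r => π h)

theorem tensorRep_tprod {G : Type w} [Group G] (π : Representation k G V) (g : G)
    (x : Fin r → V) :
    tensorRep r π g (PiTensorProduct.tprod k x) = PiTensorProduct.tprod k (fun i => π g (x i)) :=
  PiTensorProduct.map_tprod _ _

variable (k V)

/-- The place permutation action of the symmetric group `S_r` on `V^{⊗r}`: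
`σ (x₁ ⊗ ⋯ ⊗ xᵣ) = x_{σ⁻¹(1)} ⊗ ⋯ ⊗ x_{σ⁻¹(r)}`. -/
def placePerm : Representation k (Equiv.Perm (Fin r)) (⨂[k]^r V) where
  toFun σ := (PiTensorProduct.reindex k (fun _ : Fin r => V) σ).toLinearMap
  map_one' := by
    apply PiTensorProduct.ext
    ext x
    simp only [LinearMap.compMultilinearMap_apply, LinearEquiv.coe_coe]
    erw [PiTensorProduct.reindex_tprod]
    rfl
  map_mul' σ τ := by
    apply PiTensorProduct.ext
    ext x
    simp only [LinearMap.compMultilinearMap_apply, Module.End.mul_apply, LinearEquiv.coe_coe]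
    erw [PiTensorProduct.reindex_tprod, PiTensorProduct.reindex_tprod,
      PiTensorProduct.reindex_tprod]
    rfl

theorem placePerm_tprod (σ : Equiv.Perm (Fin r)) (x : Fin r → V) :
    placePerm k V r σ (PiTensorProduct.tprod k x) =
      PiTensorProduct.tprod k (fun i => x (σ⁻¹ i)) :=
  PiTensorProduct.reindex_tprod σ x

variable {k V}

theorem tensorRep_comm_placePerm {G : Type w} [Group G] (π : Representation k G V)
    (g : G) (σ : Equiv.Perm (Fin r)) :
    tensorRep r π g ∘ₗ placePerm k V r σ = placePerm k V r σ ∘ₗ tensorRep r π g := by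
  apply PiTensorProduct.ext
  ext x
  simp only [LinearMap.compMultilinearMap_apply, LinearMap.comp_apply, tensorRep_tprod,
    placePerm_tprod]

/-- The natural algebra homomorphism `φ : kG → End_{S_r}(V^{⊗r})`, for a group `G` acting
linearly on `V` through `π`. -/
def phi {G : Type w} [Group G] (π : Representation k G V) :
    MonoidAlgebra k G →ₐ[k] (placePerm k V r).IntertwiningMap (placePerm k V r) :=
  toCommutant (tensorRep r π) (placePerm k V r) (tensorRep_comm_placePerm r π)

/-- The natural algebra homomorphism `ρ : kS_r → End_G(V^{⊗r})`, for a group `G` acting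
linearly on `V` through `π`. -/
def rho {G : Type w} [Group G] (π : Representation k G V) :
    MonoidAlgebra k (Equiv.Perm (Fin r)) →ₐ[k] (tensorRep r π).IntertwiningMap (tensorRep r π) :=
  toCommutant (placePerm k V r) (tensorRep r π)
    (fun σ g => (tensorRep_comm_placePerm r π g σ).symm)

end SchurWeyl

end

/-!
Fix a basis of `V` with `n` elements. The tensor power then has a basis indexed by the words of
length `r` in `n` letters, and an operator commutes with the place permutations exactly if its
matrix is invariant under simultaneous permutation of the letters of the row and column index
(`isPermInvariant_toMatrix_iff`). Two statements about such matrices give the theorem, for `SL(V)`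
and for every group whose image contains `SL(V)` alike.

**Surjectivity of `φ`.** The powers `g ⊗ ⋯ ⊗ g` with `g` in `SL` span the invariant matrices
(`IsPermInvariant.mem_span_tensorPow`). A linear functional that kills all these powers is a
homogeneous polynomial of degree `r` in the entries of `g` vanishing on `SL(k)`, and it kills all
invariant matrices if the polynomial is zero. That the polynomial is zero is
`eq_zero_of_matrixEval_specialLinearGroup`: a polynomial in one parameter of degree at most `r`
vanishes identically if it vanishes on `k`, which has more than `r` elements. Applied to the
parameter of one transvection at a time, this shows that the polynomial vanishes on `SL` of an
algebraic closure, hence by homogeneity on `GL`, hence everywhere.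

**Surjectivity of `ρ`.** A matrix `T` commuting with all invariant matrices is a combination of
place permutations (`CommutesWithInvariants.mem_span_permMatrix`), over any field. This takes two
ingredients, both centred on lattice words, the words in which every initial segment contains `c`
at least as often as `c + 1`; they encode standard tableaux.

* `T` is determined by its entries at pairs of lattice words
  (`CommutesWithInvariants.eq_zero_of_lattice`). Divided powers of lowering operators are invariant.
  If `T` vanishes on words of smaller letter sum, an inclusion-exclusion over the letters `c + 1` in
  a segment violating the lattice condition (`sum_powerset_lowering`) expresses the value of `T` on
  a non-lattice word through words of the same letter sum with more weight further to the right.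
  This is applied to the columns and, after transposing, to the rows of `T`.
* For lattice words `u`, `w` with the same letters, the signed sum of all permutations carrying
  columns of `w` to columns of `u` has entry `±1` at `(u, w)`. At `(u', w')` it can be nonzero only
  if `u'` and `w'` have distinct letters in each column of `u` and `w`
  (`colAntisymmetrizer_left`, `colAntisymmetrizer_right`), and then all prefix sums of `u'` and `w'`
  are at least those of `u` and `w` (`IsLattice.prefixSum_le`). So these combinations of
  permutations are unitriangular on pairs of lattice words, up to sign, and subtracting suitable
  multiples removes all entries of `T` at such pairs.
-/

namespace SchurWeyl

/-! ### Density of the special linear group in low degree -/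

open Matrix MvPolynomial

section Density

variable {ι : Type*} [Fintype ι] [DecidableEq ι]

/-- The diagonal matrix with entries `c`, `c⁻¹` at `i`, `j` is the product of the Weyl elements
with parameters `c` and `-1`. -/
theorem diag2n_eq_prod_transvection {K : Type*} [Field K] {i j : ι} (hij : i ≠ j) {c : K}
    (hc : c ≠ 0) :
    SpecialLinearGroup.diag2n hij c hc =
      SpecialLinearGroup.transvection hij c *
      (SpecialLinearGroup.transvection hij.symm (-c⁻¹) *
      (SpecialLinearGroup.transvection hij c *
      (SpecialLinearGroup.transvection hij (-1) *
      (SpecialLinearGroup.transvection hij.symm 1 *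
      SpecialLinearGroup.transvection hij (-1))))) := by
  apply Subtype.ext
  rw [SpecialLinearGroup.diag2n_coe]
  change _ = transvection i j c * (transvection j i (-c⁻¹) * (transvection i j c *
    (transvection i j (-1) * (transvection j i 1 * transvection i j (-1)))))
  ext p q
  rcases eq_or_ne p i with rfl | hpi
  · simp only [transvection_mul_apply_same, transvection_mul_apply_of_ne _ _ _ _ hij,
      transvection_mul_apply_of_ne _ _ _ _ hij.symm]
    rcases eq_or_ne q p with rfl | hqp
    · simp [transvection, hij, hij.symm, hc]
    · rcases eq_or_ne q j with rfl | hqj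
      · simp [transvection, hij, hc]
      · simp [transvection, hij, hqp.symm, hqj.symm]
  · rcases eq_or_ne p j with rfl | hpj
    · simp only [transvection_mul_apply_same, transvection_mul_apply_of_ne _ _ _ _ hij,
        transvection_mul_apply_of_ne _ _ _ _ hij.symm]
      rcases eq_or_ne q p with rfl | hqp
      · simp [transvection, hij, hij.symm]
      · rcases eq_or_ne q i with rfl | hqi
        · simp [transvection, hij, hij.symm, hc]
        · simp [transvection, hqp.symm, hqi.symm]
    · simp only [transvection_mul_apply_of_ne _ _ _ _ hpi, transvection_mul_apply_of_ne _ _ _ _ hpj]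
      rcases eq_or_ne p q with rfl | hpq
      · simp [transvection, hpi, hpj, hpi.symm]
      · simp [transvection, hpi.symm, hpq]

/-- Special linear matrices over a field are products of transvections, as an induction
principle. -/
theorem specialLinearGroup_transvection_induction {K : Type*} [Field K]
    (Q : SpecialLinearGroup ι K → Prop) (hone : Q 1)
    (htransvec : ∀ (i j : ι) (hij : i ≠ j) (a : K), Q (SpecialLinearGroup.transvection hij a))
    (hmul : ∀ A B, Q A → Q B → Q (A * B)) (g : SpecialLinearGroup ι K) : Q g := by
  cases subsingleton_or_nontrivial ι
  · convert hone
    ext i j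
    have h := g.det_coe
    rw [Matrix.det_eq_elem_of_subsingleton _ i] at h
    rw [Subsingleton.elim j i, h]
    simp
  · refine SpecialLinearGroup.diagonal_transvection_induction' Q g (fun i j hij c hc => ?_)
      htransvec hmul
    rw [diag2n_eq_prod_transvection]
    exact hmul _ _ (htransvec _ _ _ _) <| hmul _ _ (htransvec _ _ _ _) <|
      hmul _ _ (htransvec _ _ _ _) <| hmul _ _ (htransvec _ _ _ _) <|
      hmul _ _ (htransvec _ _ _ _) (htransvec _ _ _ _)

variable {k : Type*} [Field k] {r : ℕ}

/-- A polynomial in one variable over an extension of `k` that vanishes on `k` and has degree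
smaller than the number of elements of `k` is zero. -/
theorem polynomial_eq_zero_of_eval_algebraMap {K : Type*} [Field K] [Algebra k K]
    (hr : (r : Cardinal) < Cardinal.mk k) (p : Polynomial K) (hp : p.natDegree ≤ r)
    (h : ∀ s : k, p.eval (algebraMap k K s) = 0) : p = 0 := by
  obtain ⟨s, hs⟩ : ∃ s : Finset k, s.card = r + 1 := by
    have h1 : ((r + 1 : ℕ) : Cardinal) ≤ Cardinal.mk k := by
      rw [Nat.cast_add_one]
      exact Cardinal.natCast_add_one_le_iff.2 hr
    obtain ⟨s, hs⟩ := Cardinal.exists_finset_eq_card h1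
    exact ⟨s, hs.symm⟩
  refine Polynomial.eq_zero_of_natDegree_lt_card_of_eval_eq_zero' p
    (s.map ⟨algebraMap k K, (algebraMap k K).injective⟩) ?_ ?_
  · intro x hx
    obtain ⟨y, -, rfl⟩ := Finset.mem_map.1 hx
    exact h y
  · rw [Finset.card_map, hs]; omega

/-- The value of a polynomial in matrix entries at a matrix over an algebra. -/
noncomputable def matrixEval {K : Type*} [CommRing K] [Algebra k K] (P : MvPolynomial (ι × ι) k)
    (M : Matrix ι ι K) : K :=
  aeval (fun p : ι × ι => M p.1 p.2) P

theorem eval_aeval_polynomial {σ K : Type*} [Field K] [Algebra k K] (P : MvPolynomial σ k)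
    (f : σ → Polynomial K) (s : K) :
    (aeval f P).eval s = aeval (fun q => (f q).eval s) P := by
  induction P using MvPolynomial.induction_on with
  | C a =>
    rw [aeval_C, aeval_C, Polynomial.algebraMap_apply, Polynomial.eval_C]
  | add p q hp hq => rw [map_add, map_add, Polynomial.eval_add, hp, hq]
  | mul_X p i hp => rw [map_mul, map_mul, Polynomial.eval_mul, hp, aeval_X, aeval_X]

/-- If `P` has degree less than the number of elements of `k` and vanishes at `A + s B` for all `s`
in `k`, it does so for all `s` in an extension field. -/
theorem matrixEval_add_smul_eq_zero {κ K : Type*} [Field K] [Algebra k K]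
    (hr : (r : Cardinal) < Cardinal.mk k) (P : MvPolynomial (κ × κ) k) (hP : P.totalDegree ≤ r)
    (A B : Matrix κ κ K) (h : ∀ s : k, matrixEval P (A + algebraMap k K s • B) = 0) (s : K) :
    matrixEval P (A + s • B) = 0 := by
  let f : κ × κ → Polynomial K := fun q =>
    Polynomial.C (B q.1 q.2) * Polynomial.X + Polynomial.C (A q.1 q.2)
  have hp : ∀ s : K, (aeval f P).eval s = matrixEval P (A + s • B) := by
    intro s
    rw [eval_aeval_polynomial, matrixEval]
    congr 2
    funext q
    simp only [f, Polynomial.eval_add, Polynomial.eval_mul, Polynomial.eval_C, Polynomial.eval_X,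
      Matrix.add_apply, Matrix.smul_apply, smul_eq_mul]
    ring
  have h0 : aeval f P = 0 := by
    refine polynomial_eq_zero_of_eval_algebraMap hr _ ?_ fun s => ?_
    · have hd : (map (algebraMap k K) P).totalDegree ≤ r :=
        (Finset.sup_mono (support_map_subset _ P)).trans hP
      have hf : ∀ q, (f q).natDegree ≤ 1 := fun q => Polynomial.natDegree_linear_le
      have := MvPolynomial.aeval_natDegree_le _ hd f hf
      rwa [mul_one, aeval_map_algebraMap] at this
    · rw [hp, h]
  rw [← hp, h0, Polynomial.eval_zero]

/-- If `P` has degree less than the number of elements of `k`, its zeros pass from `SL(k)`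
to `SL(K)` for every extension field `K`: on a product, one transvection factor at a time can be
moved, because the value is then a polynomial of low degree in the parameter. -/
theorem matrixEval_specialLinearGroup_eq_zero {K : Type*} [Field K] [Algebra k K]
    (hr : (r : Cardinal) < Cardinal.mk k) (P : MvPolynomial (ι × ι) k) (hP : P.totalDegree ≤ r)
    (h : ∀ g : SpecialLinearGroup ι k, matrixEval P g.1 = 0)
    (g : SpecialLinearGroup ι K) : matrixEval P g.1 = 0 := by
  have e_transvection : ∀ (i j : ι) (s : k), (transvection i j s).map (algebraMap k K) =
      transvection i j (algebraMap k K s) := by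
    intro i j s
    rw [transvection, transvection, Matrix.map_add _ (map_add _),
      Matrix.map_one _ (map_zero _) (map_one _), Matrix.map_single _ _ _ (algebraMap k K)]
  have hmain : ∀ a : Matrix ι ι K,
      (∀ N : SpecialLinearGroup ι k, matrixEval P (a * N.1.map (algebraMap k K)) = 0) →
      ∀ N : SpecialLinearGroup ι k, matrixEval P (a * g.1 * N.1.map (algebraMap k K)) = 0 := by
    refine specialLinearGroup_transvection_induction (fun g => ∀ a : Matrix ι ι K,
      (∀ N : SpecialLinearGroup ι k, matrixEval P (a * N.1.map (algebraMap k K)) = 0) →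
      ∀ N : SpecialLinearGroup ι k, matrixEval P (a * g.1 * N.1.map (algebraMap k K)) = 0)
      ?_ ?_ ?_ g
    · intro a ha N
      change matrixEval P (a * (1 : Matrix ι ι K) * _) = 0
      rw [Matrix.mul_one]
      exact ha N
    · intro i j hij s a ha N
      change matrixEval P (a * transvection i j s * _) = 0
      have hM : ∀ s : K, a * transvection i j s * N.1.map (algebraMap k K) =
          a * N.1.map (algebraMap k K) + s • (a * single i j 1 * N.1.map (algebraMap k K)) := by
        intro s
        rw [transvection, mul_add, add_mul, mul_one, show single i j s = s • single i j (1 : K) by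
          rw [smul_single, smul_eq_mul, mul_one], Matrix.mul_smul, Matrix.smul_mul]
      rw [hM]
      refine matrixEval_add_smul_eq_zero hr P hP _ _ (fun s => ?_) s
      rw [← hM, ← e_transvection, mul_assoc, ← Matrix.map_mul]
      exact ha (SpecialLinearGroup.transvection hij s * N)
    · intro A B hA hB a ha N
      have := hB (a * A.1) (hA a ha) N
      change matrixEval P (a * (A.1 * B.1) * _) = 0
      rwa [← mul_assoc a]
  have h1 := hmain 1 (fun N => ?_) 1
  · change matrixEval P (1 * g.1 * (1 : Matrix ι ι k).map _) = 0 at h1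
    rwa [Matrix.map_one _ (map_zero _) (map_one _), mul_one, one_mul] at h1
  · have h1 := congrArg (algebraMap k K) (h N)
    rw [map_zero, matrixEval, ← MvPolynomial.aeval_algebraMap_apply] at h1
    rw [Matrix.one_mul]
    exact h1

theorem matrixEval_smul {κ K : Type*} [Field K] [Algebra k K] {P : MvPolynomial (κ × κ) k}
    (hP : P.IsHomogeneous r) (c : K) (M : Matrix κ κ K) :
    matrixEval P (c • M) = c ^ r * matrixEval P M := by
  rw [matrixEval, matrixEval, aeval_def, aeval_def, eval₂_eq, eval₂_eq, Finset.mul_sum]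
  refine Finset.sum_congr rfl fun d hd => ?_
  have hdeg : ∑ i ∈ d.support, d i = r := by
    have := hP (mem_support_iff.1 hd)
    simpa [Finsupp.weight_apply, Finsupp.sum] using this
  simp only [Matrix.smul_apply, smul_eq_mul, mul_pow, Finset.prod_mul_distrib]
  rw [Finset.prod_pow_eq_pow_sum, hdeg]
  ring

/-- A homogeneous polynomial in the matrix entries, of degree less than the number of elements of
`k`, is zero if it vanishes on `SL(k)`. -/
theorem eq_zero_of_matrixEval_specialLinearGroup (hr : (r : Cardinal) < Cardinal.mk k)
    (P : MvPolynomial (ι × ι) k) (hP : P.IsHomogeneous r)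
    (h : ∀ g : SpecialLinearGroup ι k, matrixEval P g.1 = 0) : P = 0 := by
  let K := AlgebraicClosure k
  have hSL := matrixEval_specialLinearGroup_eq_zero (K := K) hr P hP.totalDegree_le h
  have hGL : ∀ M : Matrix ι ι K, M.det ≠ 0 → matrixEval P M = 0 := by
    intro M hM
    -- over an algebraically closed field, scaling brings the determinant to `1`
    obtain ⟨c, hc0, hc⟩ : ∃ c : K, c ≠ 0 ∧ c ^ Fintype.card ι * M.det = 1 := by
      rcases isEmpty_or_nonempty ι with hι | hι
      · exact ⟨1, one_ne_zero, by simp⟩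
      · obtain ⟨c, hc⟩ := IsAlgClosed.exists_pow_nat_eq (M.det)⁻¹ (n := Fintype.card ι)
          Fintype.card_pos
        refine ⟨c, ?_, by rw [hc, inv_mul_cancel₀ hM]⟩
        rintro rfl
        rw [zero_pow Fintype.card_ne_zero] at hc
        exact inv_ne_zero hM hc.symm
    have h1 := hSL ⟨c • M, by rw [det_smul, hc]⟩
    rw [matrixEval_smul hP] at h1
    exact (mul_eq_zero.1 h1).resolve_left (pow_ne_zero _ hc0)
  have hdet : map (algebraMap k K) P * (Matrix.mvPolynomialX ι ι K).det = 0 := by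
    apply MvPolynomial.funext
    intro x
    let M : Matrix ι ι K := Matrix.of fun i j => x (i, j)
    have h1 : eval x (map (algebraMap k K) P) = matrixEval P M := by
      rw [eval_map, matrixEval, aeval_def]
      rfl
    have h2 : eval x (Matrix.mvPolynomialX ι ι K).det = M.det := by
      rw [RingHom.map_det]
      congr 1
      ext i j
      simp [M]
    rw [map_mul, map_zero, h1, h2]
    by_cases hM : M.det = 0
    · rw [hM, mul_zero]
    · rw [hGL M hM, zero_mul]
  have := (mul_eq_zero.1 hdet).resolve_right (det_mvPolynomialX_ne_zero ι K)
  exact MvPolynomial.map_injective _ (algebraMap k K).injective (by rw [this, map_zero])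

end Density

/-! ### Kronecker powers span the invariant matrices -/

open Matrix MvPolynomial

section Span

/-- The `r`-th Kronecker power of a matrix, indexed by words of length `r`. -/
def tensorPow {ι k : Type*} [CommRing k] (r : ℕ) (M : Matrix ι ι k) :
    Matrix (Fin r → ι) (Fin r → ι) k :=
  Matrix.of fun u v => ∏ a, M (u a) (v a)

/-- A matrix indexed by words is invariant if it does not change when the letters of the row and of
the column index are permuted simultaneously; these are the matrices of the `S_r`-equivariant
operators. -/
def IsPermInvariant {ι k : Type*} {r : ℕ} (ξ : Matrix (Fin r → ι) (Fin r → ι) k) : Prop :=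
  ∀ (σ : Equiv.Perm (Fin r)) (u v : Fin r → ι), ξ (u ∘ σ) (v ∘ σ) = ξ u v

/-- Two words with the same letters, counted with multiplicity, differ by a permutation. -/
theorem exists_perm_of_sum_single_eq {κ : Type*} {r : ℕ} {w w' : Fin r → κ}
    (h : ∑ a, Finsupp.single (w a) 1 = ∑ a, Finsupp.single (w' a) (1 : ℕ)) :
    ∃ σ : Equiv.Perm (Fin r), w = w' ∘ σ := by
  classical
  have hcard : ∀ p, Nonempty ({a // w a = p} ≃ {a // w' a = p}) := by
    intro p
    have hp := DFunLike.congr_fun h p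
    simp only [Finsupp.finsetSum_apply, Finsupp.single_apply] at hp
    rw [Finset.sum_boole, Finset.sum_boole] at hp
    refine ⟨Fintype.equivOfCardEq ?_⟩
    rw [Fintype.card_subtype, Fintype.card_subtype]
    exact_mod_cast hp
  let e := fun p => (hcard p).some
  refine ⟨Equiv.ofFiberEquiv e, ?_⟩
  funext a
  exact (Equiv.ofFiberEquiv_map e a).symm

variable {ι : Type*} [Fintype ι] [DecidableEq ι] {k : Type*} [Field k] {r : ℕ}

/-- The polynomial whose coefficients are the values of a linear functional `f` on the matrix
units; its value at a matrix `M` is `f (M ⊗ ⋯ ⊗ M)`. -/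
noncomputable def functionalPoly (f : Matrix (Fin r → ι) (Fin r → ι) k →ₗ[k] k) :
    MvPolynomial (ι × ι) k :=
  ∑ w : Fin r → ι × ι, C (f (Matrix.single (fun a => (w a).1) (fun a => (w a).2) 1)) * ∏ a, X (w a)

theorem functionalPoly_isHomogeneous (f : Matrix (Fin r → ι) (Fin r → ι) k →ₗ[k] k) :
    (functionalPoly f).IsHomogeneous r := by
  refine IsHomogeneous.sum _ _ _ fun w _ => ?_
  have h := IsHomogeneous.prod Finset.univ (fun a => (X (w a) : MvPolynomial (ι × ι) k))
    (fun _ => 1) fun a _ => isHomogeneous_X k (w a)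
  have h' := (isHomogeneous_C (ι × ι)
    (f (Matrix.single (fun a => (w a).1) (fun a => (w a).2) 1))).mul h
  simpa using h'

theorem functional_apply (f : Matrix (Fin r → ι) (Fin r → ι) k →ₗ[k] k)
    (T : Matrix (Fin r → ι) (Fin r → ι) k) :
    f T = ∑ w : Fin r → ι × ι, T (fun a => (w a).1) (fun a => (w a).2) *
      f (Matrix.single (fun a => (w a).1) (fun a => (w a).2) 1) := by
  rw [← (Equiv.arrowProdEquivProdArrow (Fin r) (fun _ => ι) (fun _ => ι)).symm.sum_comp,
    Fintype.sum_prod_type]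
  conv_lhs => rw [Matrix.matrix_eq_sum_single T]
  rw [map_sum]
  refine Finset.sum_congr rfl fun u _ => ?_
  rw [map_sum]
  refine Finset.sum_congr rfl fun v _ => ?_
  change _ = T u v * f (Matrix.single u v 1)
  rw [← smul_eq_mul, ← map_smul, smul_single, smul_eq_mul, mul_one]

theorem matrixEval_functionalPoly (f : Matrix (Fin r → ι) (Fin r → ι) k →ₗ[k] k)
    (M : Matrix ι ι k) : matrixEval (functionalPoly f) M = f (tensorPow r M) := by
  rw [functional_apply, matrixEval, functionalPoly, map_sum]
  refine Finset.sum_congr rfl fun w _ => ?_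
  rw [map_mul, map_prod, aeval_C, mul_comm]
  simp only [aeval_X]
  rfl

/-- The coefficients of `functionalPoly f` are the sums of the values of `f` over the orbits of
matrix units, so `f` kills the orbit sums if the polynomial is zero. -/
theorem functional_eq_zero_of_isPermInvariant (f : Matrix (Fin r → ι) (Fin r → ι) k →ₗ[k] k)
    (hf : functionalPoly f = 0) {ξ : Matrix (Fin r → ι) (Fin r → ι) k} (hξ : IsPermInvariant ξ) :
    f ξ = 0 := by
  classical
  let mon : (Fin r → ι × ι) → (ι × ι →₀ ℕ) := fun w => ∑ a, Finsupp.single (w a) 1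
  rw [functional_apply, ← Finset.sum_fiberwise_of_maps_to
    (t := Finset.univ.image mon) (g := mon)
    (fun w _ => Finset.mem_image_of_mem _ (Finset.mem_univ w))]
  refine Finset.sum_eq_zero fun m hm => ?_
  obtain ⟨w₀, -, rfl⟩ := Finset.mem_image.1 hm
  have hcoeff : ∑ w with mon w = mon w₀,
      f (Matrix.single (fun a => (w a).1) (fun a => (w a).2) 1) = 0 := by
    have h := congrArg (coeff (mon w₀)) hf
    rw [functionalPoly, coeff_sum, coeff_zero] at h
    rw [Finset.sum_filter]
    refine Eq.trans ?_ h
    refine Finset.sum_congr rfl fun w _ => ?_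
    have : ∏ a, (X (w a) : MvPolynomial (ι × ι) k) = monomial (mon w) 1 := by
      simp only [mon, X]
      rw [← monomial_sum_one]
    rw [this, coeff_C_mul, coeff_monomial]
    simp
  -- the entries of an invariant matrix are constant on the set of index pairs with a given monomial
  have hconst : ∀ w ∈ Finset.univ.filter (fun w => mon w = mon w₀),
      ξ (fun a => (w a).1) (fun a => (w a).2) *
        f (Matrix.single (fun a => (w a).1) (fun a => (w a).2) 1) =
      ξ (fun a => (w₀ a).1) (fun a => (w₀ a).2) *
        f (Matrix.single (fun a => (w a).1) (fun a => (w a).2) 1) := by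
    intro w hw
    obtain ⟨σ, hσ⟩ := exists_perm_of_sum_single_eq (Finset.mem_filter.1 hw).2
    congr 1
    rw [hσ]
    exact hξ σ (fun a => (w₀ a).1) (fun a => (w₀ a).2)
  rw [Finset.sum_congr rfl hconst, ← Finset.mul_sum, hcoeff, mul_zero]

/-- If `k` has more than `r` elements, the `r`-th Kronecker powers of special linear matrices span
the invariant matrices. -/
theorem IsPermInvariant.mem_span_tensorPow (hr : (r : Cardinal) < Cardinal.mk k)
    {ξ : Matrix (Fin r → ι) (Fin r → ι) k} (hξ : IsPermInvariant ξ) :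
    ξ ∈ Submodule.span k (Set.range fun g : SpecialLinearGroup ι k => tensorPow r g.1) := by
  by_contra hn
  obtain ⟨f, hfξ, hf⟩ := Submodule.exists_le_ker_of_notMem hn
  refine hfξ (functional_eq_zero_of_isPermInvariant f ?_ hξ)
  refine eq_zero_of_matrixEval_specialLinearGroup hr _ (functionalPoly_isHomogeneous f) fun g => ?_
  rw [matrixEval_functionalPoly]
  exact hf (Submodule.subset_span ⟨g, rfl⟩)

end Span

/-! ### Matrices commuting with the invariant matrices -/

open Matrix

section Commutant

variable {k : Type*} [Field k] {n r : ℕ}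

/-- The matrices commuting with all invariant matrices. -/
def CommutesWithInvariants (T : Matrix (Fin r → Fin n) (Fin r → Fin n) k) : Prop :=
  ∀ ξ, IsPermInvariant ξ → T * ξ = ξ * T

theorem CommutesWithInvariants.transpose {T : Matrix (Fin r → Fin n) (Fin r → Fin n) k}
    (hT : CommutesWithInvariants T) : CommutesWithInvariants Tᵀ := by
  intro ξ hξ
  have h := hT ξᵀ fun σ u v => hξ σ v u
  rw [← Matrix.transpose_transpose ξ, ← Matrix.transpose_mul, ← Matrix.transpose_mul, h]

/-- Projecting to the words with a given value of an invariant `f` shows that `T` preserves `f`. -/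
theorem CommutesWithInvariants.eq_of_apply_ne_zero {α : Type*}
    {T : Matrix (Fin r → Fin n) (Fin r → Fin n) k} (hT : CommutesWithInvariants T)
    (f : (Fin r → Fin n) → α) (hf : ∀ (σ : Equiv.Perm (Fin r)) u, f (u ∘ σ) = f u)
    {u v : Fin r → Fin n} (h : T u v ≠ 0) : f u = f v := by
  classical
  by_contra hne
  have h1 := hT (Matrix.diagonal fun w => if f w = f v then 1 else 0) ?_
  · have h2 := congrFun (congrFun h1 u) v
    rw [Matrix.mul_diagonal, Matrix.diagonal_mul, if_pos rfl, if_neg hne, mul_one, zero_mul] at h2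
    exact h h2
  · intro σ u v
    have : u ∘ σ = v ∘ σ ↔ u = v := σ.surjective.injective_comp_right.eq_iff
    simp only [Matrix.diagonal_apply, this, hf]

/-! ### Straightening into lattice words -/

/-- The sum of the letters of a word. -/
def letterSum (w : Fin r → Fin n) : ℕ := ∑ a, (w a : ℕ)

/-- A weight that grows when letters move to the right: increasing by one the letter at a single
position outweighs decreasing by one the letters at all earlier positions. -/
def lateWeight (w : Fin r → Fin n) : ℕ := ∑ a, (w a : ℕ) * (r + 1) ^ (a : ℕ)

/-- A lattice word: every initial segment contains each letter `c` at least as often as `c + 1`. -/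
def IsLattice (w : Fin r → Fin n) : Prop :=
  ∀ (m : ℕ) (c d : Fin n), (d : ℕ) = c + 1 →
    (Finset.univ.filter fun a : Fin r => (a : ℕ) < m ∧ w a = d).card ≤
      (Finset.univ.filter fun a : Fin r => (a : ℕ) < m ∧ w a = c).card

theorem letterSum_comp (σ : Equiv.Perm (Fin r)) (w : Fin r → Fin n) :
    letterSum (w ∘ σ) = letterSum w :=
  Equiv.sum_comp σ fun a => (w a : ℕ)

/-- The divided power of a lowering operator, restricted to the target words with exactly `N`
letters `d`: it sends a word to the sum of the words with `N` letters `d` obtained by replacing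
letters `c` by `d`. -/
def lowering (c d : Fin n) (N : ℕ) : Matrix (Fin r → Fin n) (Fin r → Fin n) k :=
  Matrix.of fun u w =>
    if (∀ a, u a = w a ∨ (w a = c ∧ u a = d)) ∧ (Finset.univ.filter fun a => u a = d).card = N
    then 1 else 0

theorem card_filter_comp (σ : Equiv.Perm (Fin r)) (u : Fin r → Fin n) (c : Fin n) :
    (Finset.univ.filter fun a => (u ∘ σ) a = c).card =
      (Finset.univ.filter fun a => u a = c).card := by
  refine Finset.card_bij (fun a _ => σ a) (fun a ha => by simpa using ha)
    (fun a _ b _ h => σ.injective h) fun b hb => ⟨σ.symm b, by simpa using hb, by simp⟩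

theorem lowering_isPermInvariant (c d : Fin n) (N : ℕ) :
    IsPermInvariant (lowering (k := k) (r := r) c d N) := by
  intro σ u v
  simp only [lowering, Matrix.of_apply, card_filter_comp]
  congr 2
  exact propext (σ.forall_congr_right (q := fun a => u a = v a ∨ v a = c ∧ u a = d))

/-- Inclusion-exclusion over the subsets `S` of a set `B` of positions of the letter `d`: the
alternating sum of the images of the words in which the letters of `B ∖ S` are lowered to `c`
consists of words without a `d` in `B`. -/
theorem sum_powerset_lowering {c d : Fin n} (hcd : c ≠ d) (v : Fin r → Fin n) (B : Finset (Fin r))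
    (hB : ∀ a ∈ B, v a = d) (u : Fin r → Fin n) :
    ∑ S ∈ B.powerset, (-1 : k) ^ S.card *
      lowering (k := k) c d (Finset.univ.filter fun a => v a = d).card u
        (fun a => if a ∈ B \ S then c else v a) =
    if (∀ a ∈ B, u a = c) ∧ (∀ a ∉ B, u a = v a ∨ (v a = c ∧ u a = d)) ∧
      (Finset.univ.filter fun a => u a = d).card = (Finset.univ.filter fun a => v a = d).card
    then 1 else 0 := by
  classical
  let Bu := B.filter fun a => u a = d
  let good : Prop := (∀ a ∈ B, u a = c ∨ u a = d) ∧ (∀ a ∉ B, u a = v a ∨ (v a = c ∧ u a = d)) ∧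
      (Finset.univ.filter fun a => u a = d).card = (Finset.univ.filter fun a => v a = d).card
  have h1 : ∀ S ∈ B.powerset, (-1 : k) ^ S.card *
      lowering (k := k) c d (Finset.univ.filter fun a => v a = d).card u
        (fun a => if a ∈ B \ S then c else v a) =
      if good ∧ S ⊆ Bu then (-1 : k) ^ S.card else 0 := by
    intro S hS
    rw [Finset.mem_powerset] at hS
    simp only [lowering, Matrix.of_apply, mul_ite, mul_one, mul_zero]
    congr 1
    apply propext
    constructor
    · rintro ⟨h, hN⟩
      refine ⟨⟨fun a ha => ?_, fun a ha => ?_, hN⟩, fun a ha => ?_⟩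
      · have := h a
        have := hB a ha
        split_ifs at * <;> grind
      · simpa [ha] using h a
      · have := h a
        have := hB a (hS ha)
        have h' : a ∉ B \ S := fun h => (Finset.mem_sdiff.1 h).2 ha
        exact Finset.mem_filter.2 ⟨hS ha, by grind⟩
    · rintro ⟨⟨h, h', hN⟩, hSB⟩
      refine ⟨fun a => ?_, hN⟩
      by_cases ha : a ∈ B
      · by_cases haS : a ∈ S
        · have := (Finset.mem_filter.1 (hSB haS)).2
          simp [haS, this, hB a ha]
        · simpa [ha, haS] using h a ha
      · simpa [ha] using h' a ha
  rw [Finset.sum_congr rfl h1]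
  by_cases hg : good
  · simp only [hg, true_and]
    rw [← Finset.sum_filter]
    have h2 : B.powerset.filter (fun S => S ⊆ Bu) = Bu.powerset := by
      ext S
      simp only [Finset.mem_filter, Finset.mem_powerset]
      exact ⟨fun h => h.2, fun h => ⟨h.trans (Finset.filter_subset _ _), h⟩⟩
    have h3 : ∑ S ∈ Bu.powerset, (-1 : k) ^ S.card = if Bu = ∅ then 1 else 0 := by
      have := congrArg (Int.cast : ℤ → k) (Finset.sum_powerset_neg_one_pow_card (x := Bu))
      push_cast at this
      rw [this]
    rw [h2, h3]
    congr 1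
    apply propext
    rw [Finset.filter_eq_empty_iff]
    exact ⟨fun h => ⟨fun a ha => (hg.1 a ha).resolve_right (h ha), hg.2⟩,
      fun h a ha => by rw [h.1 a ha]; exact hcd⟩
  · simp only [hg, false_and, if_false, Finset.sum_const_zero]
    rw [if_neg]
    exact fun h => hg ⟨fun a ha => Or.inl (h.1 a ha), h.2⟩

/-- The straightening step. If `T` vanishes on the words of smaller letter sum, its value on a
non-lattice word is a combination of its values on words of the same letter sum and of larger
`lateWeight`, hence vanishes if these do. -/
theorem CommutesWithInvariants.apply_eq_zero_of_not_isLattice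
    {T : Matrix (Fin r → Fin n) (Fin r → Fin n) k} (hT : CommutesWithInvariants T)
    (u v : Fin r → Fin n) (hsmall : ∀ x w, letterSum w < letterSum v → T x w = 0)
    (hlate : ∀ w, letterSum w = letterSum v → lateWeight v < lateWeight w → T u w = 0)
    (hv : ¬ IsLattice v) : T u v = 0 := by
  classical
  unfold IsLattice at hv
  push Not at hv
  obtain ⟨m, c, d, hcd, hlt⟩ := hv
  have hne : c ≠ d := by rintro rfl; omega
  set B := Finset.univ.filter fun a : Fin r => (a : ℕ) < m ∧ v a = d with hBdef
  have hB : ∀ a ∈ B, v a = d := fun a ha => (Finset.mem_filter.1 ha).2.2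
  set N := (Finset.univ.filter fun a => v a = d).card with hN
  let low : Finset (Fin r) → Fin r → Fin n := fun S a => if a ∈ B \ S then c else v a
  let L : Matrix (Fin r → Fin n) (Fin r → Fin n) k := lowering c d N
  have hlow : ∀ S ∈ B.powerset, S ≠ B →
      (T * L) u (low S) = 0 := by
    intro S hS hSB
    rw [hT _ (lowering_isPermInvariant c d N : IsPermInvariant L), Matrix.mul_apply]
    refine Finset.sum_eq_zero fun x _ => ?_
    rw [hsmall x, mul_zero]
    obtain ⟨a, haB, haS⟩ := Finset.exists_of_ssubset ((Finset.mem_powerset.1 hS).ssubset_of_ne hSB)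
    refine Finset.sum_lt_sum (fun b _ => ?_) ⟨a, Finset.mem_univ _, ?_⟩
    · by_cases hb : b ∈ B \ S
      · have := hB b (Finset.mem_sdiff.1 hb).1
        simp only [low, if_pos hb, this]; omega
      · simp only [low, if_neg hb]; exact le_rfl
    · have := hB a haB
      simp only [low, if_pos (Finset.mem_sdiff.2 ⟨haB, haS⟩), this]; omega
  have hfull : (T * L) u (low B) = T u v := by
    have h1 : low B = v := by funext a; simp [low]
    rw [h1, Matrix.mul_apply, Finset.sum_eq_single v]
    · simp [L, lowering, hN]
    · intro x _ hx
      simp only [L]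
      rw [lowering, Matrix.of_apply, if_neg, mul_zero]
      rintro ⟨h, hx'⟩
      -- the words `x` and `v` have equally many letters `d`, so nothing was replaced
      have hsub : (Finset.univ.filter fun a => v a = d) ⊆ Finset.univ.filter fun a => x a = d := by
        intro a ha
        have := h a
        simp only [Finset.mem_filter, Finset.mem_univ, true_and] at *
        grind
      have heq := Finset.eq_of_subset_of_card_le hsub hx'.le
      apply hx
      funext a
      rcases h a with h' | ⟨h1, h2⟩
      · exact h'
      · have : a ∈ Finset.univ.filter fun a => v a = d := by rw [heq]; simp [h2]
        rw [h2, (Finset.mem_filter.1 this).2]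
    · simp
  have hsum : ∑ S ∈ B.powerset, (-1 : k) ^ S.card * (T * L) u (low S) =
      (-1) ^ B.card * T u v := by
    rw [Finset.sum_eq_single B, hfull]
    · intro S hS hSB
      rw [hlow S hS hSB, mul_zero]
    · intro h
      exact absurd (Finset.mem_powerset_self B) h
  have hzero : ∑ S ∈ B.powerset, (-1 : k) ^ S.card * (T * L) u (low S) = 0 := by
    simp only [Matrix.mul_apply, Finset.mul_sum]
    rw [Finset.sum_comm]
    refine Finset.sum_eq_zero fun x _ => ?_
    have h1 := sum_powerset_lowering (k := k) hne v B hB x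
    have h2 : ∑ S ∈ B.powerset, (-1 : k) ^ S.card * (T u x * L x (low S)) =
        T u x * ∑ S ∈ B.powerset, (-1 : k) ^ S.card * L x (low S) := by
      rw [Finset.mul_sum]
      exact Finset.sum_congr rfl fun S _ => by ring
    rw [h2, h1]
    split_ifs with hx
    · obtain ⟨hxB, hxv, hxN⟩ := hx
      rw [mul_one]
      -- `G` is the set of positions where a letter `c` of `v` became `d`
      set G := Finset.univ.filter fun a => v a = c ∧ x a = d with hG
      have hpoint : ∀ a, (x a : ℕ) + (if a ∈ B then 1 else 0) = v a + if a ∈ G then 1 else 0 := by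
        intro a
        by_cases ha : a ∈ B
        · have h3 : a ∉ G := by simp [hG, hB a ha, hne.symm]
          rw [if_pos ha, if_neg h3, hxB a ha, hB a ha]; omega
        · rw [if_neg ha]
          rcases hxv a ha with h3 | ⟨h3, h4⟩
          · have h5 : a ∉ G := by simp only [hG, Finset.mem_filter, h3]; grind
            rw [if_neg h5, h3]
          · have h5 : a ∈ G := by simp [hG, h3, h4]
            rw [if_pos h5, h3, h4]; omega
      have hcard : G.card = B.card := by
        have h3 : Disjoint G ((Finset.univ.filter fun a => v a = d) \ B) := by
          rw [Finset.disjoint_left]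
          intro a
          simp only [hG, Finset.mem_filter, Finset.mem_sdiff]
          grind
        have h4 : (Finset.univ.filter fun a => x a = d) =
            G ∪ ((Finset.univ.filter fun a => v a = d) \ B) := by
          ext a
          have := hxB a
          have := hxv a
          have := hB a
          simp only [hG, Finset.mem_filter, Finset.mem_sdiff, Finset.mem_union, Finset.mem_univ]
          grind
        have h5 : B ⊆ Finset.univ.filter fun a => v a = d := fun a ha => by simp [hB a ha]
        have h6 := Finset.card_le_card h5
        rw [h4, Finset.card_union_of_disjoint h3, Finset.card_sdiff_of_subset h5] at hxN
        omega
      apply hlate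
      · have h3 := Finset.sum_congr (s₁ := Finset.univ) rfl fun a _ => hpoint a
        rw [Finset.sum_add_distrib, Finset.sum_add_distrib] at h3
        simp only [Finset.sum_ite_mem, Finset.univ_inter, Finset.sum_const, smul_eq_mul,
          hcard] at h3
        unfold letterSum
        omega
      · -- one of the new letters `d` lies to the right of `B`
        obtain ⟨g, hgG, hgm⟩ : ∃ g ∈ G, m ≤ (g : ℕ) := by
          by_contra! hcon
          refine absurd (Finset.card_le_card (s := G) (t := Finset.univ.filter
            fun a : Fin r => (a : ℕ) < m ∧ v a = c) fun a ha => ?_) (by omega)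
          have := hcon a ha
          simp only [hG, Finset.mem_filter] at ha ⊢
          tauto
        have h3 : ∑ a, ((x a : ℕ) + if a ∈ B then 1 else 0) * (r + 1) ^ (a : ℕ) =
            ∑ a, ((v a : ℕ) + if a ∈ G then 1 else 0) * (r + 1) ^ (a : ℕ) :=
          Finset.sum_congr rfl fun a _ => by rw [hpoint]
        simp only [add_mul, Finset.sum_add_distrib, ite_mul, one_mul, zero_mul,
          Finset.sum_ite_mem, Finset.univ_inter] at h3
        have h4 : ∑ a ∈ B, (r + 1) ^ (a : ℕ) < ∑ a ∈ G, (r + 1) ^ (a : ℕ) := by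
          have h5 : (∑ a ∈ B, (r + 1) ^ (a : ℕ)) * (r + 1) ≤ B.card * (r + 1) ^ m := by
            rw [Finset.sum_mul, ← smul_eq_mul B.card]
            refine Finset.sum_le_card_nsmul _ _ _ fun a ha => ?_
            rw [← pow_succ]
            exact Nat.pow_le_pow_right (Nat.succ_pos r) (Finset.mem_filter.1 ha).2.1
          have h6 : B.card < r + 1 := Nat.lt_succ_of_le (by simpa using Finset.card_le_univ B)
          have h7 : (r + 1) ^ m ≤ ∑ a ∈ G, (r + 1) ^ (a : ℕ) :=
            (Nat.pow_le_pow_right (Nat.succ_pos r) hgm).trans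
              (Finset.single_le_sum (f := fun a : Fin r => (r + 1) ^ (a : ℕ))
                (fun _ _ => Nat.zero_le _) hgG)
          have h8 : 0 < (r + 1) ^ m := Nat.pow_pos (Nat.succ_pos r)
          nlinarith
        unfold lateWeight
        omega
    · rw [mul_zero]
  rw [hsum] at hzero
  exact (mul_eq_zero.1 hzero).resolve_left (pow_ne_zero _ (neg_ne_zero.2 one_ne_zero))

end Commutant

open Matrix

section Lattice

variable {k : Type*} [Field k] {n r : ℕ}

/-- Iterated straightening of the column index, the row index being fixed. -/
theorem CommutesWithInvariants.apply_eq_zero_of_lattice_columns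
    {T : Matrix (Fin r → Fin n) (Fin r → Fin n) k} (hT : CommutesWithInvariants T) {s : ℕ}
    (hsmall : ∀ x w, letterSum w < s → T x w = 0) (u : Fin r → Fin n)
    (hlattice : ∀ v, IsLattice v → letterSum v = s → T u v = 0) (v : Fin r → Fin n)
    (hv : letterSum v = s) : T u v = 0 := by
  induction hM : (Finset.univ.sup (lateWeight (n := n) (r := r)) - lateWeight v)
    using Nat.strong_induction_on generalizing v with
  | _ M ih =>
    by_cases hlat : IsLattice v
    · exact hlattice v hlat hv
    · refine hT.apply_eq_zero_of_not_isLattice u v (fun x w hw => hsmall x w (hv ▸ hw))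
        (fun w hw hlt => ih _ ?_ w (hw.trans hv) rfl) hlat
      have := Finset.le_sup (f := lateWeight (n := n) (r := r)) (Finset.mem_univ w)
      omega

/-- A matrix commuting with all invariant matrices is determined by its entries whose row and
column index are lattice words. -/
theorem CommutesWithInvariants.eq_zero_of_lattice
    {T : Matrix (Fin r → Fin n) (Fin r → Fin n) k} (hT : CommutesWithInvariants T)
    (h : ∀ u v, IsLattice u → IsLattice v → T u v = 0) : T = 0 := by
  have hsum : ∀ u v, T u v ≠ 0 → letterSum u = letterSum v := fun u v =>
    hT.eq_of_apply_ne_zero letterSum letterSum_comp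
  have key : ∀ s, ∀ u v, letterSum v = s → T u v = 0 := by
    intro s
    induction s using Nat.strong_induction_on with
    | _ s ih =>
      have hcols : ∀ u, IsLattice u → ∀ v, letterSum v = s → T u v = 0 := fun u hu v hv =>
        hT.apply_eq_zero_of_lattice_columns (fun x w hw => ih _ hw x w rfl) u
          (fun v hv _ => h u v hu hv) v hv
      intro u v hv
      by_contra hne
      refine hne (hT.transpose.apply_eq_zero_of_lattice_columns (s := s) (fun x w hw => ?_) v
        (fun u hu _ => hcols u hu v hv) u ((hsum u v hne).trans hv))
      by_contra hne'
      exact hne' (ih _ hw w x (hsum w x hne').symm)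
  ext u v
  exact key _ u v rfl

/-! ### Columns of a lattice word -/

/-- The number of earlier occurrences of the letter at position `a`. Reading a lattice word as a
standard tableau (position `a` lies in row `w a`), this is the column that contains `a`. -/
def col (w : Fin r → Fin n) (a : Fin r) : ℕ :=
  (Finset.univ.filter fun x : Fin r => x < a ∧ w x = w a).card

theorem col_lt_col (w : Fin r → Fin n) {a b : Fin r} (hab : a < b) (h : w a = w b) :
    col w a < col w b := by
  refine Finset.card_lt_card ⟨fun x hx => ?_, fun hsub => ?_⟩
  · simp only [Finset.mem_filter, Finset.mem_univ, true_and] at hx ⊢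
    exact ⟨hx.1.trans hab, hx.2.trans h⟩
  · have : a ∈ Finset.univ.filter fun x : Fin r => x < a ∧ w x = w a := hsub (by simp [hab, h])
    simp at this

theorem col_injective (w : Fin r → Fin n) {a b : Fin r} (hw : w a = w b) (hc : col w a = col w b) :
    a = b := by
  rcases lt_trichotomy a b with h | h | h
  · exact absurd hc (col_lt_col w h hw).ne
  · exact h
  · exact absurd hc (col_lt_col w h hw.symm).ne'

/-- The positions of the letter `c` before `m` lie in the columns `0, 1, …`, without gaps. -/
theorem col_lt_iff (w : Fin r → Fin n) (m : ℕ) (c : Fin n) (j : ℕ) :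
    (∃ a : Fin r, (a : ℕ) < m ∧ w a = c ∧ col w a = j) ↔
      j < (Finset.univ.filter fun a : Fin r => (a : ℕ) < m ∧ w a = c).card := by
  classical
  set s := Finset.univ.filter fun a : Fin r => (a : ℕ) < m ∧ w a = c with hs
  have hinj : Set.InjOn (col w) s := by
    intro a ha b hb h
    have ha := (Finset.mem_filter.1 ha).2
    have hb := (Finset.mem_filter.1 hb).2
    exact col_injective w (ha.2.trans hb.2.symm) h
  have hsub : s.image (col w) ⊆ Finset.range s.card := by
    intro j hj
    obtain ⟨a, ha, rfl⟩ := Finset.mem_image.1 hj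
    have ha' := (Finset.mem_filter.1 ha).2
    refine Finset.mem_range.2 (Finset.card_lt_card ⟨fun x hx => ?_, fun h => ?_⟩)
    · have hx := (Finset.mem_filter.1 hx).2
      have h1 : (x : ℕ) < a := hx.1
      exact Finset.mem_filter.2 ⟨Finset.mem_univ _, by omega, hx.2.trans ha'.2⟩
    · simpa using (Finset.mem_filter.1 (h ha)).2.1
  have heq : s.image (col w) = Finset.range s.card :=
    Finset.eq_of_subset_of_card_le hsub (by rw [Finset.card_image_of_injOn hinj, Finset.card_range])
  rw [← Finset.mem_range, ← heq, Finset.mem_image]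
  simp only [hs, Finset.mem_filter, Finset.mem_univ, true_and, and_assoc]

/-- Two words with equally many occurrences of every letter are related by the permutation that
matches the `j`-th occurrences of each letter. -/
theorem exists_perm_of_card_eq {u w : Fin r → Fin n}
    (h : ∀ c, (Finset.univ.filter fun a => u a = c).card =
      (Finset.univ.filter fun a => w a = c).card) :
    ∃ σ : Equiv.Perm (Fin r), w = u ∘ σ ∧ ∀ a, col u (σ a) = col w a := by
  have hex : ∀ a, ∃ b, u b = w a ∧ col u b = col w a := by
    intro a
    have h1 := (col_lt_iff w r (w a) (col w a)).1 ⟨a, a.2, rfl, rfl⟩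
    obtain ⟨b, -, hb⟩ := (col_lt_iff u r (w a) (col w a)).2 (by simpa [h] using h1)
    exact ⟨b, hb⟩
  choose f hf using hex
  have hinj : Function.Injective f := fun a b hab =>
    col_injective w (by rw [← (hf a).1, hab, (hf b).1]) (by rw [← (hf a).2, hab, (hf b).2])
  refine ⟨Equiv.ofBijective f (Finite.injective_iff_bijective.1 hinj), ?_, fun a => (hf a).2⟩
  funext a
  exact (hf a).1.symm

theorem IsLattice.exists_lt {w : Fin r → Fin n} (hw : IsLattice w) {a : Fin r} {c : Fin n}
    (hc : (w a : ℕ) = c + 1) : ∃ b < a, w b = c ∧ col w b = col w a := by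
  have h1 := (col_lt_iff w (a + 1) (w a) (col w a)).1 ⟨a, by omega, rfl, rfl⟩
  obtain ⟨b, hb, hbc, hcol⟩ := (col_lt_iff w (a + 1) c (col w a)).2
    (h1.trans_le (hw _ c (w a) hc))
  refine ⟨b, lt_of_le_of_ne (Nat.lt_succ_iff.1 hb) ?_, hbc, hcol⟩
  rintro rfl
  rw [hbc] at hc
  omega

/-- Among the injective functions on `s` with natural values, those with a downward closed image
have the smallest sum. -/
theorem sum_le_sum_of_injOn {α : Type*} (s : Finset α) (f g : α → ℕ) (hf : Set.InjOn f s)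
    (hg : Set.InjOn g s) (hdown : ∀ a ∈ s, ∀ c < f a, ∃ b ∈ s, f b = c) :
    ∑ a ∈ s, f a ≤ ∑ a ∈ s, g a := by
  classical
  have hsf : ∑ a ∈ s, f a = ∑ x ∈ s.image f, x := (Finset.sum_image (f := fun x => x) hf).symm
  have hsg : ∑ a ∈ s, g a = ∑ x ∈ s.image g, x := (Finset.sum_image (f := fun x => x) hg).symm
  rw [hsf, hsg]
  have hcard : (s.image f).card = (s.image g).card := by
    rw [Finset.card_image_of_injOn hf, Finset.card_image_of_injOn hg]
  have hdown' : ∀ x ∈ s.image f, ∀ c < x, c ∈ s.image f := by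
    intro x hx c hc
    obtain ⟨a, ha, rfl⟩ := Finset.mem_image.1 hx
    obtain ⟨b, hb, rfl⟩ := hdown a ha c hc
    exact Finset.mem_image_of_mem _ hb
  generalize s.image f = A at *
  generalize s.image g = B at *
  -- the elements of `A` outside `B` are smaller than those of `B` outside `A`
  have h1 : (A \ B).card = (B \ A).card := by
    have := Finset.card_sdiff_add_card_inter A B
    have h2 := Finset.card_sdiff_add_card_inter B A
    rw [Finset.inter_comm] at h2
    omega
  have h2 : ∀ x ∈ A \ B, ∀ y ∈ B \ A, x ≤ y := by
    intro x hx y hy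
    by_contra! hlt
    exact (Finset.mem_sdiff.1 hy).2 (hdown' x (Finset.mem_sdiff.1 hx).1 y hlt)
  have h3 : ∑ x ∈ A \ B, x ≤ ∑ x ∈ B \ A, x := by
    let e := Finset.equivOfCardEq h1
    rw [← Finset.sum_coe_sort, ← Finset.sum_coe_sort (B \ A), ← e.sum_comp]
    exact Finset.sum_le_sum fun x _ => h2 _ x.2 _ (e x).2
  rw [← Finset.sum_inter_add_sum_sdiff A B, ← Finset.sum_inter_add_sum_sdiff B A,
    Finset.inter_comm]
  exact Nat.add_le_add_left h3 _

/-- The sum of the first `m` letters of a word. -/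
def prefixSum (w : Fin r → Fin n) (m : ℕ) : ℕ :=
  ∑ a ∈ Finset.univ.filter fun a : Fin r => (a : ℕ) < m, (w a : ℕ)

/-- A lattice word has the smallest prefix sums among the words with distinct letters in each of
its columns: the part of a column before `m` carries the letters `0, 1, …`, without gaps. -/
theorem IsLattice.prefixSum_le {w w' : Fin r → Fin n} (hw : IsLattice w)
    (hw' : ∀ a b, col w a = col w b → w' a = w' b → a = b) (m : ℕ) :
    prefixSum w m ≤ prefixSum w' m := by
  classical
  unfold prefixSum
  set s := Finset.univ.filter fun a : Fin r => (a : ℕ) < m with hs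
  rw [← Finset.sum_fiberwise_of_maps_to (t := s.image (col w)) (g := col w)
      (fun a ha => Finset.mem_image_of_mem _ ha),
    ← Finset.sum_fiberwise_of_maps_to (t := s.image (col w)) (g := col w)
      (fun a ha => Finset.mem_image_of_mem _ ha) (fun a => (w' a : ℕ))]
  refine Finset.sum_le_sum fun j _ => sum_le_sum_of_injOn _ _ _ ?_ ?_ ?_
  · intro a ha b hb h
    exact col_injective w (Fin.ext h)
      ((Finset.mem_filter.1 ha).2.trans (Finset.mem_filter.1 hb).2.symm)
  · intro a ha b hb h
    exact hw' a b ((Finset.mem_filter.1 ha).2.trans (Finset.mem_filter.1 hb).2.symm) (Fin.ext h)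
  · have step : ∀ N, ∀ a ∈ s.filter (fun a => col w a = j), (w a : ℕ) = N →
        ∀ c < N, ∃ b ∈ s.filter (fun a => col w a = j), (w b : ℕ) = c := by
      intro N
      induction N with
      | zero => intro a _ _ c hc; omega
      | succ N ih =>
        intro a ha hN c hc
        obtain ⟨b, hba, hb, hcol⟩ := hw.exists_lt (a := a) (c := ⟨N, by omega⟩) hN
        have hbs : b ∈ s.filter (fun a => col w a = j) := by
          simp only [hs, Finset.mem_filter, Finset.mem_univ, true_and] at ha ⊢
          have : (b : ℕ) < a := hba
          exact ⟨by omega, hcol.trans ha.2⟩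
        have hbN : (w b : ℕ) = N := by rw [hb]
        rcases Nat.lt_succ_iff_lt_or_eq.1 hc with h | rfl
        · exact ih b hbs hbN c h
        · exact ⟨b, hbs, hbN⟩
    intro a ha c hc
    exact step _ a ha rfl c hc

theorem eq_of_prefixSum_eq {w w' : Fin r → Fin n} (h : ∀ m ≤ r, prefixSum w m = prefixSum w' m) :
    w = w' := by
  have hstep : ∀ (w : Fin r → Fin n) (a : Fin r), prefixSum w (a + 1) = prefixSum w a + w a := by
    intro w a
    have : (Finset.univ.filter fun b : Fin r => (b : ℕ) < a + 1) =
        insert a (Finset.univ.filter fun b : Fin r => (b : ℕ) < a) := by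
      ext b
      simp only [Finset.mem_filter, Finset.mem_univ, true_and, Finset.mem_insert, Fin.ext_iff]
      omega
    rw [prefixSum, this, Finset.sum_insert (by simp), add_comm, prefixSum]
  funext a
  have h1 := h a a.2.le
  have h2 := h (a + 1) a.2
  rw [hstep, hstep] at h2
  exact Fin.ext (by omega)

/-- The sum of all prefix sums of a word, the order of elimination. -/
def height (w : Fin r → Fin n) : ℕ := ∑ m ∈ Finset.range (r + 1), prefixSum w m

theorem IsLattice.height_le {w w' : Fin r → Fin n} (hw : IsLattice w)
    (hw' : ∀ a b, col w a = col w b → w' a = w' b → a = b) : height w ≤ height w' :=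
  Finset.sum_le_sum fun m _ => hw.prefixSum_le hw' m

theorem IsLattice.eq_of_height_le {w w' : Fin r → Fin n} (hw : IsLattice w)
    (hw' : ∀ a b, col w a = col w b → w' a = w' b → a = b) (h : height w' ≤ height w) :
    w = w' := by
  have h1 := (Finset.sum_eq_sum_iff_of_le fun m _ => hw.prefixSum_le hw' m).1
    ((hw.height_le hw').antisymm h)
  exact eq_of_prefixSum_eq fun m hm => h1 m (Finset.mem_range.2 (by omega))

/-! ### Elimination by column antisymmetrizers -/

/-- The matrix of the place permutation by `σ`. -/
def permMatrix (k : Type*) [Field k] {n r : ℕ} (σ : Equiv.Perm (Fin r)) :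
    Matrix (Fin r → Fin n) (Fin r → Fin n) k :=
  Matrix.of fun u v => if v = u ∘ σ then 1 else 0

theorem permMatrix_commutesWithInvariants (σ : Equiv.Perm (Fin r)) :
    CommutesWithInvariants (permMatrix k (n := n) σ) := by
  intro ξ hξ
  ext u v
  rw [Matrix.mul_apply, Matrix.mul_apply, Finset.sum_eq_single (u ∘ σ),
    Finset.sum_eq_single (v ∘ σ.symm)]
  · have h1 : v = (v ∘ σ.symm) ∘ σ := by funext a; simp
    simp only [permMatrix, Matrix.of_apply, if_true, if_pos h1, one_mul, mul_one]
    conv_lhs => rw [h1]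
    exact hξ σ u _
  · intro w _ hw
    simp only [permMatrix, Matrix.of_apply]
    rw [if_neg, mul_zero]
    rintro rfl
    exact hw (by funext a; simp)
  · simp
  · intro w _ hw
    simp only [permMatrix, Matrix.of_apply]
    rw [if_neg hw, zero_mul]
  · simp

/-- The signed sum of the permutations carrying each column of `w` to the same column of `u`: a
translate of a column antisymmetrizer. -/
def colAntisymmetrizer (k : Type*) [Field k] {n r : ℕ} (u w : Fin r → Fin n) :
    Matrix (Fin r → Fin n) (Fin r → Fin n) k :=
  ∑ σ : Equiv.Perm (Fin r) with ∀ a, col u (σ a) = col w a,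
    ((Equiv.Perm.sign σ : ℤ) : k) • permMatrix k σ

theorem colAntisymmetrizer_apply (u w u' w' : Fin r → Fin n) :
    colAntisymmetrizer k u w u' w' =
      ∑ σ ∈ Finset.univ.filter (fun σ : Equiv.Perm (Fin r) =>
          (∀ a, col u (σ a) = col w a) ∧ w' = u' ∘ σ),
        ((Equiv.Perm.sign σ : ℤ) : k) := by
  rw [colAntisymmetrizer, Matrix.sum_apply, ← Finset.filter_filter,
    Finset.sum_filter (s := Finset.filter _ _)]
  refine Finset.sum_congr rfl fun σ _ => ?_
  simp [permMatrix]

/-- If `w'` has equal letters at two positions of a column of `w`, composing with the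
transposition of these positions cancels the terms in pairs. -/
theorem colAntisymmetrizer_right {u w u' w' : Fin r → Fin n}
    (h : colAntisymmetrizer k u w u' w' ≠ 0) (a b : Fin r) (hcol : col w a = col w b)
    (hw : w' a = w' b) : a = b := by
  by_contra hab
  rw [colAntisymmetrizer_apply] at h
  refine h (Finset.sum_involution (fun σ _ => σ * Equiv.swap a b) ?_ ?_ ?_ ?_)
  · intro σ _
    rw [Equiv.Perm.sign_mul, Equiv.Perm.sign_swap hab]
    simp
  · intro σ _ _ heq
    exact hab (Equiv.swap_eq_one_iff.1 (mul_eq_left.1 heq))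
  · intro σ hσ
    have hs : ∀ {β : Type} (f : Fin r → β), f a = f b → ∀ x, f (Equiv.swap a b x) = f x := by
      intro β f hf x
      rcases eq_or_ne x a with rfl | hxa
      · rw [Equiv.swap_apply_left, hf]
      · rcases eq_or_ne x b with rfl | hxb
        · rw [Equiv.swap_apply_right, hf]
        · rw [Equiv.swap_apply_of_ne_of_ne hxa hxb]
    obtain ⟨h1, h2⟩ := (Finset.mem_filter.1 hσ).2
    refine Finset.mem_filter.2 ⟨Finset.mem_univ _, fun x => ?_, ?_⟩
    · rw [Equiv.Perm.mul_apply, h1, hs (col w) hcol]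
    · funext x
      rw [← hs w' hw x, h2]
      rfl
  · intro σ _
    simp [mul_assoc]

theorem colAntisymmetrizer_left {u w u' w' : Fin r → Fin n}
    (h : colAntisymmetrizer k u w u' w' ≠ 0) (a b : Fin r) (hcol : col u a = col u b)
    (hu : u' a = u' b) : a = b := by
  obtain ⟨σ, hσ, -⟩ := Finset.exists_ne_zero_of_sum_ne_zero
    (by rwa [colAntisymmetrizer_apply] at h)
  obtain ⟨h1, h2⟩ := (Finset.mem_filter.1 hσ).2
  refine σ.symm.injective (colAntisymmetrizer_right h _ _ ?_ ?_)
  · rw [← h1, ← h1, σ.apply_symm_apply, σ.apply_symm_apply, hcol]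
  · rw [h2]
    simp [hu]

/-- Only one permutation contributes to this entry, since a position is determined by its letter
and its column. -/
theorem colAntisymmetrizer_self {u w : Fin r → Fin n}
    (h : ∀ c, (Finset.univ.filter fun a => u a = c).card =
      (Finset.univ.filter fun a => w a = c).card) : colAntisymmetrizer k u w u w ≠ 0 := by
  obtain ⟨σ, hσ, hcol⟩ := exists_perm_of_card_eq h
  rw [colAntisymmetrizer_apply, Finset.sum_eq_single σ]
  · rcases Int.units_eq_one_or (Equiv.Perm.sign σ) with h | h <;> simp [h]
  · intro τ hτ hne
    obtain ⟨h1, h2⟩ := (Finset.mem_filter.1 hτ).2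
    refine absurd (Equiv.ext fun a => col_injective u ?_ ((h1 a).trans (hcol a).symm)) hne
    exact (congrFun h2 a).symm.trans (congrFun hσ a)
  · intro hn
    exact absurd (Finset.mem_filter.2 ⟨Finset.mem_univ _, hcol, hσ⟩) hn

theorem colAntisymmetrizer_mem_span (u w : Fin r → Fin n) :
    colAntisymmetrizer k u w ∈ Submodule.span k (Set.range (permMatrix k (n := n) (r := r))) :=
  Submodule.sum_mem _ fun σ _ => Submodule.smul_mem _ _ (Submodule.subset_span ⟨σ, rfl⟩)

theorem commutesWithInvariants_of_mem_span {T : Matrix (Fin r → Fin n) (Fin r → Fin n) k}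
    (hT : T ∈ Submodule.span k (Set.range (permMatrix k (n := n) (r := r)))) :
    CommutesWithInvariants T := by
  intro ξ hξ
  induction hT using Submodule.span_induction with
  | mem x hx =>
    obtain ⟨σ, rfl⟩ := hx
    exact permMatrix_commutesWithInvariants σ ξ hξ
  | zero => simp
  | add x y _ _ hx hy => rw [add_mul, mul_add, hx, hy]
  | smul c x _ hx => rw [Matrix.smul_mul, Matrix.mul_smul, hx]

/-- The double centralizer property: a matrix commuting with all invariant matrices is a
combination of place permutations. -/
theorem CommutesWithInvariants.mem_span_permMatrix
    {T : Matrix (Fin r → Fin n) (Fin r → Fin n) k} (hT : CommutesWithInvariants T) :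
    T ∈ Submodule.span k (Set.range (permMatrix k (n := n) (r := r))) := by
  classical
  have sub_comm : ∀ Q ∈ Submodule.span k (Set.range (permMatrix k (n := n) (r := r))),
      CommutesWithInvariants (T - Q) := fun Q hQ ξ hξ => by
    rw [sub_mul, mul_sub, hT ξ hξ, commutesWithInvariants_of_mem_span hQ ξ hξ]
  have key : ∀ N, ∃ Q ∈ Submodule.span k (Set.range (permMatrix k (n := n) (r := r))),
      ∀ u w, IsLattice u → IsLattice w → height u + height w < N → (T - Q) u w = 0 := by
    intro N
    induction N with
    | zero => exact ⟨0, Submodule.zero_mem _, fun u w _ _ h => absurd h (Nat.not_lt_zero _)⟩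
    | succ N ih =>
      obtain ⟨Q, hQ, hzero⟩ := ih
      let I : Finset ((Fin r → Fin n) × (Fin r → Fin n)) := Finset.univ.filter fun p =>
        IsLattice p.1 ∧ IsLattice p.2 ∧ height p.1 + height p.2 = N
      let q : (Fin r → Fin n) × (Fin r → Fin n) → k := fun p =>
        (T - Q) p.1 p.2 / colAntisymmetrizer k p.1 p.2 p.1 p.2
      refine ⟨Q + ∑ p ∈ I, q p • colAntisymmetrizer k p.1 p.2, Submodule.add_mem _ hQ
        (Submodule.sum_mem _ fun p _ => Submodule.smul_mem _ _ (colAntisymmetrizer_mem_span _ _)),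
        fun u w hu hw hN => ?_⟩
      -- an entry of height at most `N` is met by no summand except its own
      have hother : ∀ p ∈ I, p ≠ (u, w) → (q p • colAntisymmetrizer k p.1 p.2) u w = 0 := by
        intro p hp hne
        obtain ⟨h1, h2, h3⟩ := (Finset.mem_filter.1 hp).2
        rw [Matrix.smul_apply, smul_eq_mul]
        by_contra hcon
        have hcon := right_ne_zero_of_mul hcon
        have hl := colAntisymmetrizer_left hcon
        have hr := colAntisymmetrizer_right hcon
        have h4 := h1.height_le hl
        have h5 := h2.height_le hr
        have hu' : height u ≤ height p.1 := by omega
        have hw' : height w ≤ height p.2 := by omega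
        exact hne (Prod.ext (h1.eq_of_height_le hl hu') (h2.eq_of_height_le hr hw'))
      rw [← sub_sub, Matrix.sub_apply, Matrix.sum_apply]
      rcases Nat.lt_succ_iff_lt_or_eq.1 hN with hlt | heq
      · rw [hzero u w hu hw hlt, zero_sub, neg_eq_zero]
        refine Finset.sum_eq_zero fun p hp => hother p hp ?_
        rintro rfl
        have := (Finset.mem_filter.1 hp).2.2.2
        simp only at this
        omega
      · rw [Finset.sum_eq_single (u, w) hother
          (fun h => absurd (Finset.mem_filter.2 ⟨Finset.mem_univ _, hu, hw, heq⟩) h),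
          Matrix.smul_apply, smul_eq_mul]
        simp only [q]
        by_cases hz : (T - Q) u w = 0
        · rw [hz, zero_div, zero_mul, sub_zero]
        · rw [div_mul_cancel₀, sub_self]
          refine colAntisymmetrizer_self fun c => ?_
          exact (sub_comm Q hQ).eq_of_apply_ne_zero
            (fun w => (Finset.univ.filter fun a => w a = c).card)
            (fun σ u => card_filter_comp σ u c) hz
  obtain ⟨Q, hQ, hzero⟩ := key (Finset.univ.sup height + Finset.univ.sup height + 1)
  have h0 : T - Q = 0 := (sub_comm Q hQ).eq_zero_of_lattice fun u w hu hw => by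
    refine hzero u w hu hw ?_
    have h1 := Finset.le_sup (f := height (n := n) (r := r)) (Finset.mem_univ u)
    have h2 := Finset.le_sup (f := height (n := n) (r := r)) (Finset.mem_univ w)
    omega
  rw [sub_eq_zero.1 h0]
  exact hQ

end Lattice

/-! ### From words to tensor powers -/

open Matrix

section Translation

variable {k : Type*} [Field k] {V : Type*} [AddCommGroup V] [Module k V] {n r : ℕ}

theorem exists_asAlgebraHom_eq_of_mem_span {G W : Type*} [Group G] [AddCommGroup W] [Module k W]
    (ρ : Representation k G W) {f : W →ₗ[k] W} (hf : f ∈ Submodule.span k (Set.range ρ)) :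
    ∃ a : MonoidAlgebra k G, ρ.asAlgebraHom a = f := by
  have h : Submodule.span k (Set.range ρ) ≤ LinearMap.range ρ.asAlgebraHom.toLinearMap := by
    rw [Submodule.span_le]
    rintro _ ⟨g, rfl⟩
    exact ⟨MonoidAlgebra.of k G g, by simp⟩
  exact h hf

theorem toCommutant_surjective {G H W : Type*} [Group G] [Group H] [AddCommGroup W] [Module k W]
    (ρ : Representation k G W) (σ : Representation k H W) (hc : ∀ g h, ρ g ∘ₗ σ h = σ h ∘ₗ ρ g)
    (hspan : ∀ f : W →ₗ[k] W, (∀ h, f ∘ₗ σ h = σ h ∘ₗ f) → f ∈ Submodule.span k (Set.range ρ)) :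
    Function.Surjective (toCommutant ρ σ hc) := by
  intro f
  obtain ⟨a, ha⟩ := exists_asAlgebraHom_eq_of_mem_span ρ (hspan f.toLinearMap f.isIntertwining')
  refine ⟨a, ?_⟩
  have h := (toCommutant_toLinearMap ρ σ hc a).trans ha
  ext x
  exact LinearMap.congr_fun h x

/-- The basis of the tensor power indexed by words. -/
noncomputable def wordBasis (r : ℕ) (b : Module.Basis (Fin n) k V) :
    Module.Basis (Fin r → Fin n) k (⨂[k]^r V) :=
  Basis.piTensorProduct fun _ : Fin r => b

theorem wordBasis_apply (b : Module.Basis (Fin n) k V) (w : Fin r → Fin n) :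
    wordBasis r b w = PiTensorProduct.tprod k fun a => b (w a) :=
  Basis.piTensorProduct_apply _ _

theorem toMatrix_tensorRep {G : Type*} [Group G] (b : Module.Basis (Fin n) k V)
    (π : Representation k G V) (g : G) :
    LinearMap.toMatrix (wordBasis r b) (wordBasis r b) (tensorRep r π g) =
      tensorPow r (LinearMap.toMatrix b b (π g)) := by
  ext u w
  rw [LinearMap.toMatrix_apply, wordBasis_apply, tensorRep_tprod, wordBasis,
    Basis.piTensorProduct_repr_tprod_apply]
  simp only [tensorPow, Matrix.of_apply, LinearMap.toMatrix_apply]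

theorem toMatrix_placePerm (b : Module.Basis (Fin n) k V) (σ : Equiv.Perm (Fin r)) :
    LinearMap.toMatrix (wordBasis r b) (wordBasis r b) (placePerm k V r σ) = permMatrix k σ := by
  ext u w
  have h : placePerm k V r σ (wordBasis r b w) = wordBasis r b (w ∘ σ.symm) := by
    rw [wordBasis_apply, wordBasis_apply, placePerm_tprod]
    rfl
  rw [LinearMap.toMatrix_apply, h, Module.Basis.repr_self, Finsupp.single_apply, permMatrix,
    Matrix.of_apply]
  congr 1
  apply propext
  constructor
  · rintro rfl
    funext a; simp
  · rintro rfl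
    funext a; simp

/-- An operator is equivariant for the place permutations exactly if its matrix is invariant. -/
theorem isPermInvariant_toMatrix_iff (b : Module.Basis (Fin n) k V)
    (f : (⨂[k]^r V) →ₗ[k] ⨂[k]^r V) :
    IsPermInvariant (LinearMap.toMatrix (wordBasis r b) (wordBasis r b) f) ↔
      ∀ σ, f ∘ₗ placePerm k V r σ = placePerm k V r σ ∘ₗ f := by
  set ξ := LinearMap.toMatrix (wordBasis r b) (wordBasis r b) f with hξdef
  have hiff : ∀ σ, f ∘ₗ placePerm k V r σ = placePerm k V r σ ∘ₗ f ↔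
      ξ * permMatrix k σ = permMatrix k σ * ξ := by
    intro σ
    rw [← (LinearMap.toMatrix (wordBasis r b) (wordBasis r b)).injective.eq_iff,
      LinearMap.toMatrix_comp _ (wordBasis r b), LinearMap.toMatrix_comp _ (wordBasis r b),
      toMatrix_placePerm]
  simp only [hiff]
  constructor
  · exact fun h σ => (permMatrix_commutesWithInvariants σ ξ h).symm
  · intro h σ u v
    have h1 := congrFun (congrFun (h σ) u) (v ∘ σ)
    rw [Matrix.mul_apply, Matrix.mul_apply, Finset.sum_eq_single v,
      Finset.sum_eq_single (u ∘ σ)] at h1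
    · simpa [permMatrix] using h1.symm
    · intro w _ hw
      simp [permMatrix, hw]
    · simp
    · intro w _ hw
      have : v ∘ σ ≠ w ∘ σ := fun h => hw (σ.surjective.injective_comp_right h).symm
      simp [permMatrix, this]
    · simp

theorem mem_span_range_of_toMatrix {α W : Type*} [AddCommGroup W] [Module k W] {κ : Type*}
    [Fintype κ] [DecidableEq κ] (B : Module.Basis κ k W) (ρ : α → W →ₗ[k] W) {f : W →ₗ[k] W}
    {β : Type*} (M : β → Matrix κ κ k)
    (hM : ∀ y, ∃ x, M y = LinearMap.toMatrix B B (ρ x))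
    (hf : LinearMap.toMatrix B B f ∈ Submodule.span k (Set.range M)) :
    f ∈ Submodule.span k (Set.range ρ) := by
  have h : Submodule.span k (Set.range M) ≤
      (Submodule.span k (Set.range ρ)).map (LinearMap.toMatrix B B).toLinearMap := by
    rw [Submodule.span_le]
    rintro _ ⟨y, rfl⟩
    obtain ⟨x, hx⟩ := hM y
    exact ⟨ρ x, Submodule.subset_span ⟨x, rfl⟩, hx.symm⟩
  obtain ⟨f', hf', heq⟩ := h hf
  rwa [(LinearMap.toMatrix B B).injective heq] at hf'

/-- The equivariant operators are spanned by the diagonal action of `SL(V)`, hence by that of any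
group whose image in `GL(V)` contains `SL(V)`. -/
theorem mem_span_tensorRep {G : Type*} [Group G] (π : Representation k G V)
    (b : Module.Basis (Fin n) k V) (hr : (r : Cardinal) < Cardinal.mk k)
    (hπ : ∀ g : SpecialLinearGroup k V, ∃ x, π x = slNat k V g)
    (f : (⨂[k]^r V) →ₗ[k] ⨂[k]^r V)
    (hf : ∀ σ, f ∘ₗ placePerm k V r σ = placePerm k V r σ ∘ₗ f) :
    f ∈ Submodule.span k (Set.range (tensorRep r π)) := by
  refine mem_span_range_of_toMatrix (wordBasis r b) _ _ (fun y => ?_)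
    (((isPermInvariant_toMatrix_iff b f).2 hf).mem_span_tensorPow hr)
  obtain ⟨x, hx⟩ := hπ (Matrix.SpecialLinearGroup.toLin_equiv b y)
  refine ⟨x, ?_⟩
  have h : slNat k V (Matrix.SpecialLinearGroup.toLin_equiv b y) = Matrix.toLin b b y.1 := rfl
  rw [toMatrix_tensorRep, hx, h, LinearMap.toMatrix_toLin]

/-- Operators commuting with the group commute with all equivariant operators, so the double
centralizer property applies. -/
theorem mem_span_placePerm {G : Type*} [Group G] (π : Representation k G V)
    (b : Module.Basis (Fin n) k V) (hr : (r : Cardinal) < Cardinal.mk k)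
    (hπ : ∀ g : SpecialLinearGroup k V, ∃ x, π x = slNat k V g)
    (f : (⨂[k]^r V) →ₗ[k] ⨂[k]^r V)
    (hf : ∀ g, f ∘ₗ tensorRep r π g = tensorRep r π g ∘ₗ f) :
    f ∈ Submodule.span k (Set.range (placePerm k V r)) := by
  refine mem_span_range_of_toMatrix (wordBasis r b) _ _
    (fun σ => ⟨σ, (toMatrix_placePerm b σ).symm⟩) (CommutesWithInvariants.mem_span_permMatrix ?_)
  intro ξ hξ
  obtain ⟨x, rfl⟩ := (LinearMap.toMatrix (wordBasis r b) (wordBasis r b)).surjective ξ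
  have hx := mem_span_tensorRep π b hr hπ x ((isPermInvariant_toMatrix_iff b x).1 hξ)
  rw [← LinearMap.toMatrix_comp, ← LinearMap.toMatrix_comp]
  congr 1
  clear hξ
  induction hx using Submodule.span_induction with
  | mem x hx =>
    obtain ⟨g, rfl⟩ := hx
    exact hf g
  | zero => rw [LinearMap.comp_zero, LinearMap.zero_comp]
  | add x y _ _ hx hy => rw [LinearMap.comp_add, LinearMap.add_comp, hx, hy]
  | smul c x _ hx => rw [LinearMap.comp_smul, LinearMap.smul_comp, hx]

end Translation

end SchurWeyl

theorem mainTheorem2 {k : Type*} [Field k] {V : Type*} [AddCommGroup V] [Module k V]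
    [FiniteDimensional k V] (r : ℕ) (hr : (r : Cardinal) < Cardinal.mk k) :
    (Function.Surjective (SchurWeyl.phi r (SchurWeyl.glNat k V)) ∧
      Function.Surjective (SchurWeyl.rho r (SchurWeyl.glNat k V))) ∧
    (Function.Surjective (SchurWeyl.phi r (SchurWeyl.slNat k V)) ∧
      Function.Surjective (SchurWeyl.rho r (SchurWeyl.slNat k V))) := by
  let b := Module.finBasis k V
  have hgl : ∀ g : SpecialLinearGroup k V, ∃ x, SchurWeyl.glNat k V x = SchurWeyl.slNat k V g :=
    fun g => ⟨g.toGeneralLinearGroup, rfl⟩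
  have hsl : ∀ g : SpecialLinearGroup k V, ∃ x, SchurWeyl.slNat k V x = SchurWeyl.slNat k V g :=
    fun g => ⟨g, rfl⟩
  exact ⟨⟨SchurWeyl.toCommutant_surjective _ _ _ (SchurWeyl.mem_span_tensorRep _ b hr hgl),
    SchurWeyl.toCommutant_surjective _ _ _ (SchurWeyl.mem_span_placePerm _ b hr hgl)⟩,
    SchurWeyl.toCommutant_surjective _ _ _ (SchurWeyl.mem_span_tensorRep _ b hr hsl),
    SchurWeyl.toCommutant_surjective _ _ _ (SchurWeyl.mem_span_placePerm _ b hr hsl)⟩
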